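/- Let $k$ be an infinite field. For positive integers $c_1<\dots<c_m$ (not necessarily relatively prime) put $c_0=0$ and $d=c_m$. The projective monomial curve defined by $c_1<\dots<c_m$ is the Zariski closure $\mathcal C\subset\mathbb P^m_k$ of the set of points $(u^{c_0}v^{d-c_0}:u^{c_1}v^{d-c_1}:\dots:u^{c_m}v^{d-c_m})$, $(u:v)\in\mathbb P^1_k$. Its homogeneous coordinate ring is $k[\mathcal C]=k[x_0,\dots,x_m]/I(\mathcal C)$, where $I(\mathcal C)$ is the ideal generated by the homogeneous polynomials vanishing on $\mathcal C$. The curve $\mathcal C$ is called arithmetically Cohen–Macaulay if the Krull dimension of $k[\mathcal C]$ equals its depth as a $k[x_0,\dots,x_m]$-module, i.e. the supremum of the lengths of the $k[\mathcal C]$-regular sequences contained in $(x_0,\dots,x_m)$. Let $n\ge 1$, let $a_1<\dots<a_n$ be positive integers, and set $$M=a_n+(a_n-1)\sum_{i=1}^{n-1}(a_n-a_i).$$ Then for every integer $j\ge M$ with $j>a_n$, the projective monomial curve defined by $a_1<\dots<a_n<j$ is arithmetically Cohen–Macaulay. (If $n\ge2$, then $M>a_n$ and the condition $j>a_n$ is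 automatic.) -/

import Mathlib

open scoped LinearAlgebra.Projectivization

namespace MonomialCurve

section ProjectiveSets

variable {k σ : Type*} [Field k]

/-- The polynomial `F` vanishes on the set `X` of points of projective space, i.e. on all the
homogeneous coordinate vectors of all the points of `X`. -/
def VanishesOn (F : MvPolynomial σ k) (X : Set (ℙ k (σ → k))) : Prop :=
  ∀ (w : σ → k) (hw : w ≠ 0), Projectivization.mk k w hw ∈ X → MvPolynomial.eval w F = 0

/-- The Zariski closure of a set `X` of points of projective space: the points at which every
homogeneous polynomial that vanishes on `X` vanishes. -/
def zariskiClosure (X : Set (ℙ k (σ → k))) : Set (ℙ k (σ → k)) :=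
  {p | ∀ (F : MvPolynomial σ k) (m : ℕ), F.IsHomogeneous m → VanishesOn F X → VanishesOn F {p}}

/-- The (homogeneous) vanishing ideal of a set `X` of points of projective space: the ideal
generated by the homogeneous polynomials that vanish on `X`. -/
noncomputable def vanishingIdeal (X : Set (ℙ k (σ → k))) : Ideal (MvPolynomial σ k) :=
  Ideal.span {F | (∃ m : ℕ, F.IsHomogeneous m) ∧ VanishesOn F X}

/-- The homogeneous coordinate ring `k[X] = k[x] / I(X)` of a set `X` of points of projective
space. -/
noncomputable abbrev CoordinateRing (X : Set (ℙ k (σ → k))) : Type _ :=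
  MvPolynomial σ k ⧸ vanishingIdeal X

end ProjectiveSets

section CohenMacaulay

/-- The depth of the `R`-module `M` with respect to the ideal `I`: the supremum of the lengths of
the `M`-regular sequences of elements of `I`. -/
noncomputable def depth {R : Type*} [CommRing R] (I : Ideal R) (M : Type*) [AddCommGroup M]
    [Module R M] : ℕ∞ :=
  ⨆ (rs : List R) (_ : (∀ r ∈ rs, r ∈ I) ∧ RingTheory.Sequence.IsRegular M rs), (rs.length : ℕ∞)

/-- `X` is arithmetically Cohen-Macaulay: the depth of its homogeneous coordinate ring, as a module
over the polynomial ring `k[x]` (with respect to the irrelevant maximal ideal, generated by all the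
variables), equals the Krull dimension of the coordinate ring. -/
def IsArithmeticallyCohenMacaulay {k σ : Type*} [Field k] (X : Set (ℙ k (σ → k))) : Prop :=
  ((depth (Ideal.span (Set.range (MvPolynomial.X : σ → MvPolynomial σ k))) (CoordinateRing X) :
    ℕ∞) : WithBot ℕ∞) = ringKrullDim (CoordinateRing X)

end CohenMacaulay

section Curve

variable (k : Type*) [Field k] {n : ℕ}

/-- Here `a` lists `a₁ < ⋯ < a_N`, where `N = n + 1`; put `a₀ = 0` and `d = a_N`. The vector of the
monomials `u ^ aᵢ * v ^ (d - aᵢ)`, for `i = 0, …, N`. -/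
def monomialVector (a : Fin (n + 1) → ℕ) (u v : k) : Fin (n + 2) → k := fun i =>
  u ^ ((Fin.cons 0 a : Fin (n + 2) → ℕ) i) *
    v ^ (a (Fin.last n) - (Fin.cons 0 a : Fin (n + 2) → ℕ) i)

theorem monomialVector_ne_zero (a : Fin (n + 1) → ℕ) (u v : k) (h : u ≠ 0 ∨ v ≠ 0) :
    monomialVector k a u v ≠ 0 := by
  intro h0
  rcases h with hu | hv
  · have := congrFun h0 (Fin.last n).succ
    simp [monomialVector, hu] at this
  · have := congrFun h0 0
    simp [monomialVector, hv] at this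

/-- The projective monomial curve defined by `a₁ < ⋯ < a_N`: the Zariski closure in `ℙ^N` of the
set of the points `(u ^ a₀ * v ^ (d - a₀) : ⋯ : u ^ a_N * v ^ (d - a_N))` with `(u : v) ∈ ℙ^1`,
where `a₀ = 0` and `d = a_N`. -/
def projectiveMonomialCurve (a : Fin (n + 1) → ℕ) : Set (ℙ k (Fin (n + 2) → k)) :=
  zariskiClosure {p | ∃ (u v : k) (h : u ≠ 0 ∨ v ≠ 0),
    p = Projectivization.mk k (monomialVector k a u v) (monomialVector_ne_zero k a u v h)}

end Curve

end MonomialCurve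

/-!
For `c₀ = 0 < c₁ < ⋯ < c_N = d` the coordinate ring of the projective monomial curve is the
semigroup ring `k[S]`, where `S ⊆ ℕ²` is generated by the vectors `(cᵢ, d - cᵢ)`: over an infinite
field, a homogeneous polynomial vanishes on the curve exactly when it lies in the kernel of the map
`xᵢ ↦ u ^ cᵢ * v ^ (d - cᵢ)` (`vanishingIdeal_projectiveMonomialCurve`).

This ring is integral over the image of `k[u ^ d, v ^ d]`, so its dimension is at most `2`, and the
length of a regular sequence is at most the dimension. It therefore suffices to exhibit a regular
sequence of length two, and `v ^ d, u ^ d` is one as soon as every `s` with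
`s + (0, d) ∈ S` and `s + (d, 0) ∈ S` already lies in `S` (`isRegular_toric`).

An element of `S` records a value `p` together with a number `r` such that `p` is a sum of `r` terms
of `c₀, …, c_N`. The condition thus says: if both `p` and `p + d` are sums of `r` terms, then
`p` is a sum of `r - 1` terms (`IsCohenMacaulaySequence`). For the sequence `a₁ < ⋯ < a_n < j`, a sum
for `p + j` that uses `j` gives one for `p` on dropping that term. Otherwise `p + j ≤ r * a_n`. In
any sum for `p`, trading `a_n` copies of `aᵢ` for `aᵢ` copies of `a_n` makes each `aᵢ`, `i < n`, occur
at most `a_n - 1` times. If `q` terms are then nonzero,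
`a_n * q ≤ p + (a_n - 1) * ∑ i, (a_n - aᵢ) ≤ p + j - a_n ≤ a_n * (r - 1)` by the lower bound on `j`, so
`q ≤ r - 1`, and zeros fill up the sum (`exists_short_representation`).
-/

namespace MonomialCurve

section Commutative

/-! ### Depth and Krull dimension -/

/-- The length of a regular sequence is at most the dimension of the module; neither a local nor a
Noetherian hypothesis is needed for this inequality. -/
theorem length_le_supportDim_of_isRegular {R : Type*} [CommRing R] (rs : List R) :
    ∀ (M : Type*) [AddCommGroup M] [Module R M] [Module.Finite R M],
      RingTheory.Sequence.IsRegular M rs → (rs.length : WithBot ℕ∞) ≤ Module.supportDim R M := by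
  induction rs with
  | nil =>
    intro M _ _ _ h
    have : Nontrivial M := h.nontrivial
    have hb := Module.supportDim_ne_bot_of_nontrivial R M
    rw [← WithBot.coe_unbot _ hb]
    exact_mod_cast bot_le
  | cons r rs ih =>
    intro M _ _ _ h
    rw [RingTheory.Sequence.isRegular_cons_iff] at h
    refine le_trans ?_ (Module.supportDim_quotSMulTop_succ_le_of_notMem_minimalPrimes
      fun p hp => h.1.notMem_of_mem_minimalPrimes hp)
    rw [List.length_cons, Nat.cast_add, Nat.cast_one]
    gcongr
    exact ih _ h.2

theorem depth_le_of_ringKrullDim_le {R : Type*} [CommRing R] (I J : Ideal R) {n : ℕ∞}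
    (hn : ringKrullDim (R ⧸ I) ≤ n) : depth J (R ⧸ I) ≤ n :=
  iSup₂_le fun rs hrs => WithBot.coe_le_coe.1 <|
    (length_le_supportDim_of_isRegular rs _ hrs.2).trans <|
      (Module.supportDim_quotient_eq_ringKrullDim I).trans_le hn

/-- Incomparability for integral extensions bounds the dimension; injectivity is not needed. -/
theorem ringKrullDim_le_of_isIntegral {A B : Type*} [CommRing A] [CommRing B] [Algebra A B]
    [Algebra.IsIntegral A B] : ringKrullDim B ≤ ringKrullDim A :=
  Order.krullDim_le_of_strictMono (PrimeSpectrum.comap (algebraMap A B))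
    fun _ q h => Ideal.IsIntegral.comap_lt_comap (J := q.asIdeal) h

end Commutative

section Arithmetic

/-! ### Short representations by a numerical semigroup -/

open Finset

/-- If a value `p = ∑ i, b i * a i + t * m + s * j` is such that `p + j` is a sum of `r` terms from `a`
and `m` alone, then `p` is a sum of at most `r - 1` terms. Dividing each `b i` by `m` trades `m` copies
of `a i` for `a i` copies of `m`, so that the new coefficients are at most `m - 1`. -/
theorem exists_short_representation {ι : Type*} [Fintype ι] (a : ι → ℕ) (m j : ℕ)
    (ha : ∀ i, a i ≤ m) (hm : 0 < m) (hj : m + (m - 1) * ∑ i, (m - a i) ≤ j)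
    (b b' : ι → ℕ) (t t' s : ℕ)
    (h : ∑ i, b i * a i + t * m + s * j + j = ∑ i, b' i * a i + t' * m) :
    ∃ (b₁ : ι → ℕ) (t₁ : ℕ),
      ∑ i, b₁ i * a i + t₁ * m + s * j = ∑ i, b i * a i + t * m + s * j ∧
      ∑ i, b₁ i + t₁ + s + 1 ≤ ∑ i, b' i + t' := by
  have hval : ∑ i, b i % m * a i + (t + ∑ i, b i / m * a i) * m = ∑ i, b i * a i + t * m := by
    have : ∑ i, b i * a i = ∑ i, b i % m * a i + (∑ i, b i / m * a i) * m := by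
      rw [sum_mul, ← sum_add_distrib]
      refine sum_congr rfl fun i _ => ?_
      conv_lhs => rw [← Nat.mod_add_div (b i) m]
      ring
    rw [this]; ring
  refine ⟨fun i => b i % m, t + ∑ i, b i / m * a i, by rw [hval], ?_⟩
  generalize t + ∑ i, b i / m * a i = t₁ at *
  have h1 : m * ∑ i, b i % m ≤ ∑ i, b i % m * a i + (m - 1) * ∑ i, (m - a i) := by
    rw [mul_sum, mul_sum, ← sum_add_distrib]
    refine sum_le_sum fun i _ => ?_
    have h2 : b i % m * (m - a i) ≤ (m - 1) * (m - a i) :=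
      Nat.mul_le_mul_right _ (Nat.le_sub_one_of_lt (Nat.mod_lt _ hm))
    calc m * (b i % m) = b i % m * a i + b i % m * (m - a i) := by
          rw [← mul_add, Nat.add_sub_cancel' (ha i), mul_comm]
      _ ≤ _ := by gcongr
  have h3 : ∑ i, b' i * a i ≤ m * ∑ i, b' i := by
    rw [mul_sum]
    exact sum_le_sum fun i _ => by rw [mul_comm]; exact Nat.mul_le_mul_right _ (ha i)
  have h4 : s * m ≤ s * j := Nat.mul_le_mul_left _ (le_trans (Nat.le_add_right _ _) hj)
  refine Nat.le_of_mul_le_mul_left ?_ hm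
  simp only [mul_add, mul_one]
  have e1 : m * t₁ = t₁ * m := mul_comm _ _
  have e2 : m * t' = t' * m := mul_comm _ _
  have e3 : m * s = s * m := mul_comm _ _
  omega

end Arithmetic

section Toric

/-! ### The semigroup ring of a monomial curve -/

open MvPolynomial

variable {k σ : Type*} [Field k] [Fintype σ]

/-- The parametrization `xᵢ ↦ u ^ c i * v ^ (d - c i)`, with `u = X 0` and `v = X 1`. Its image is the
semigroup ring of the curve. -/
noncomputable def toricMap (k : Type*) [Field k] {σ : Type*} (c : σ → ℕ) (d : ℕ) :
    MvPolynomial σ k →ₐ[k] MvPolynomial (Fin 2) k :=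
  aeval fun i => X 0 ^ c i * X 1 ^ (d - c i)

/-- The exponent of the monomial in `u` and `v` to which `toricMap` sends the monomial with
exponent `e`. -/
noncomputable def toricExponent (c : σ → ℕ) (d : ℕ) (e : σ →₀ ℕ) : Fin 2 →₀ ℕ :=
  Finsupp.single 0 (∑ i, e i * c i) + Finsupp.single 1 (∑ i, e i * (d - c i))

theorem monomial_single_add_single (A B : ℕ) (r : k) :
    monomial (Finsupp.single (0 : Fin 2) A + Finsupp.single 1 B) r = C r * (X 0 ^ A * X 1 ^ B) := by
  rw [X_pow_eq_monomial, X_pow_eq_monomial, monomial_mul, C_mul_monomial]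
  simp

theorem toricMap_monomial (c : σ → ℕ) (d : ℕ) (e : σ →₀ ℕ) (r : k) :
    toricMap k c d (monomial e r) = monomial (toricExponent c d e) r := by
  rw [toricMap, aeval_monomial, toricExponent, monomial_single_add_single,
    Finsupp.prod_fintype _ _ (by simp), algebraMap_eq]
  simp_rw [mul_pow, ← pow_mul, Finset.prod_mul_distrib, Finset.prod_pow_eq_pow_sum, mul_comm]

theorem toricExponent_zero_add_one (c : σ → ℕ) (d : ℕ) (hc : ∀ i, c i ≤ d) (e : σ →₀ ℕ) :
    toricExponent c d e 0 + toricExponent c d e 1 = (∑ i, e i) * d := by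
  simp only [toricExponent, Finsupp.add_apply, Finsupp.single_apply]
  simp only [if_true, one_ne_zero, zero_ne_one, if_false, add_zero, zero_add]
  rw [← Finset.sum_add_distrib, Finset.sum_mul]
  refine Finset.sum_congr rfl fun i _ => ?_
  rw [← mul_add, Nat.add_sub_cancel' (hc i)]

theorem toricExponent_zero (c : σ → ℕ) (d : ℕ) (e : σ →₀ ℕ) :
    toricExponent c d e 0 = ∑ i, e i * c i := by
  simp [toricExponent]

theorem exists_of_mem_support_toricMap (c : σ → ℕ) (d : ℕ) (g : MvPolynomial σ k)
    {s : Fin 2 →₀ ℕ} (hs : s ∈ (toricMap k c d g).support) : ∃ e, toricExponent c d e = s := by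
  classical
  have : toricMap k c d g = ∑ e ∈ g.support, monomial (toricExponent c d e) (coeff e g) := by
    conv_lhs => rw [← support_sum_monomial_coeff g]
    rw [map_sum]
    exact Finset.sum_congr rfl fun e _ => toricMap_monomial c d e _
  rw [this] at hs
  obtain ⟨e, -, he⟩ := Finset.mem_biUnion.1 (support_sum hs)
  exact ⟨e, (Finset.mem_singleton.1 (support_monomial_subset he)).symm⟩

/-- The combinatorial Cohen-Macaulay criterion for the semigroup generated by the `(c i, d - c i)`.
The vectors `e`, `f`, `g` count the terms of a sum: if a value `p` and `p + d` are both sums of `r` terms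
of `c`, then `p` is a sum of `r - 1` terms of `c`. -/
def IsCohenMacaulaySequence (c : σ → ℕ) (d : ℕ) : Prop :=
  ∀ e f : σ →₀ ℕ, ∑ i, e i * c i + d = ∑ i, f i * c i → ∑ i, e i = ∑ i, f i →
    ∃ g : σ →₀ ℕ, ∑ i, g i * c i = ∑ i, e i * c i ∧ ∑ i, g i + 1 = ∑ i, e i

/-- Under the combinatorial criterion, `u ^ d` is a nonzerodivisor modulo `v ^ d` on the semigroup
ring. All the polynomials that occur are supported in the semigroup, so the criterion applies to
each monomial separately. -/
theorem exists_toricMap_eq (c : σ → ℕ) (d : ℕ) (hd : 0 < d) (hc : ∀ i, c i ≤ d)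
    (h : IsCohenMacaulaySequence c d) (p q : MvPolynomial σ k)
    (hpq : X 0 ^ d * toricMap k c d p = X 1 ^ d * toricMap k c d q) :
    ∃ g, toricMap k c d p = X 1 ^ d * toricMap k c d g := by
  have key : ∀ s ∈ (toricMap k c d p).support,
      ∃ g, Finsupp.single 1 d + toricExponent c d g = s := by
    intro s hs
    obtain ⟨e, rfl⟩ := exists_of_mem_support_toricMap c d p hs
    have h1 : coeff (Finsupp.single 0 d + toricExponent c d e)
        (X 1 ^ d * toricMap k c d q) ≠ 0 := by
      rw [← hpq, X_pow_eq_monomial, coeff_monomial_mul, one_mul]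
      exact mem_support_iff.1 hs
    rw [X_pow_eq_monomial, coeff_monomial_mul'] at h1
    split_ifs at h1 with hle
    swap
    · exact absurd rfl h1
    rw [one_mul] at h1
    obtain ⟨f, hf⟩ := exists_of_mem_support_toricMap c d q (mem_support_iff.2 h1)
    have hf' : toricExponent c d f + Finsupp.single 1 d =
        Finsupp.single 0 d + toricExponent c d e := by
      rw [hf]; exact tsub_add_cancel_of_le hle
    have hf0 := DFunLike.congr_fun hf' 0
    have hf1 := DFunLike.congr_fun hf' 1
    simp at hf0 hf1
    have se := toricExponent_zero_add_one c d hc e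
    have sf := toricExponent_zero_add_one c d hc f
    have hdeg : ∑ i, e i = ∑ i, f i := Nat.eq_of_mul_eq_mul_right hd (by omega)
    rw [toricExponent_zero, toricExponent_zero] at hf0
    obtain ⟨g, hg0, hg1⟩ := h e f (by omega) hdeg
    have sg := toricExponent_zero_add_one c d hc g
    rw [← hg1, add_mul, one_mul] at se
    rw [← toricExponent_zero c d, ← toricExponent_zero c d] at hg0
    refine ⟨g, ?_⟩
    ext i
    fin_cases i
    · simpa using hg0
    · simp; omega
  choose! g hg using key
  refine ⟨∑ s ∈ (toricMap k c d p).support, monomial (g s) (coeff s (toricMap k c d p)), ?_⟩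
  conv_lhs => rw [← support_sum_monomial_coeff (toricMap k c d p)]
  rw [map_sum, Finset.mul_sum]
  refine Finset.sum_congr rfl fun s hs => ?_
  rw [toricMap_monomial, X_pow_eq_monomial, monomial_mul, one_mul, hg s hs]

theorem toricMap_X {σ : Type*} (c : σ → ℕ) (d : ℕ) (i : σ) :
    toricMap k c d (X i) = X 0 ^ c i * X 1 ^ (d - c i) := by
  simp [toricMap]

theorem isRegular_toric (c : σ → ℕ) (d : ℕ) (hd : 0 < d) (hc : ∀ i, c i ≤ d) (i₀ i₁ : σ)
    (h0 : c i₀ = 0) (h1 : c i₁ = d) (h : IsCohenMacaulaySequence c d) :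
    RingTheory.Sequence.IsRegular (MvPolynomial σ k ⧸ RingHom.ker (toricMap k c d))
      [(X i₀ : MvPolynomial σ k), X i₁] := by
  have t0 : toricMap k c d (X i₀) = X 1 ^ d := by simp [toricMap_X, h0]
  have t1 : toricMap k c d (X i₁) = X 0 ^ d := by simp [toricMap_X, h1]
  have hmk : ∀ g : MvPolynomial σ k,
      (Ideal.Quotient.mk (RingHom.ker (toricMap k c d)) g = 0 ↔ toricMap k c d g = 0) := fun g => by
    rw [Ideal.Quotient.eq_zero_iff_mem, RingHom.mem_ker]
  refine ⟨(RingTheory.Sequence.isWeaklyRegular_cons_iff _ _ _).2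
    ⟨?_, (RingTheory.Sequence.isWeaklyRegular_cons_iff _ _ _).2 ⟨?_, .nil _ _⟩⟩, ?_⟩
  · rw [isSMulRegular_iff_right_eq_zero_of_smul]
    intro x hx
    obtain ⟨g, rfl⟩ := Ideal.Quotient.mk_surjective x
    rw [← Ideal.Quotient.mk_eq_mk, ← Submodule.Quotient.mk_smul, Ideal.Quotient.mk_eq_mk, hmk,
      smul_eq_mul, map_mul, t0] at hx
    exact (hmk g).2 ((mul_eq_zero.1 hx).resolve_left (pow_ne_zero _ (X_ne_zero 1)))
  · rw [isSMulRegular_iff_right_eq_zero_of_smul]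
    intro x hx
    obtain ⟨x, rfl⟩ := Submodule.Quotient.mk_surjective _ x
    obtain ⟨p, rfl⟩ := Ideal.Quotient.mk_surjective x
    rw [← Submodule.Quotient.mk_smul, Submodule.Quotient.mk_eq_zero,
      Submodule.mem_smul_pointwise_iff_exists] at hx
    obtain ⟨y, -, hy⟩ := hx
    obtain ⟨q, rfl⟩ := Ideal.Quotient.mk_surjective y
    have hpq : toricMap k c d (X i₁ * p - X i₀ * q) = 0 := by
      rw [← hmk, map_sub, sub_eq_zero]
      exact hy.symm
    rw [map_sub, map_mul, map_mul, t0, t1, sub_eq_zero] at hpq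
    obtain ⟨g, hg⟩ := exists_toricMap_eq c d hd hc h p q hpq
    rw [Submodule.Quotient.mk_eq_zero, Submodule.mem_smul_pointwise_iff_exists]
    refine ⟨Ideal.Quotient.mk _ g, trivial, ?_⟩
    have : Ideal.Quotient.mk (RingHom.ker (toricMap k c d)) (X i₀ * g - p) = 0 := by
      rw [hmk, map_sub, map_mul, t0, hg, sub_self]
    rw [map_sub, sub_eq_zero] at this
    exact this
  · -- The constant coefficient of the image in `k[u, v]` is `1` at `1` and vanishes on `(x_{i₀}, x_{i₁})`.
    intro htop
    let θ : MvPolynomial σ k ⧸ RingHom.ker (toricMap k c d) →+* k :=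
      Ideal.Quotient.lift _ (constantCoeff.comp (toricMap k c d).toRingHom) fun p hp => by
        have hp' : toricMap k c d p = 0 := hp
        simp [hp']
    have hle : (Ideal.ofList [(X i₀ : MvPolynomial σ k), X i₁] •
        (⊤ : Submodule (MvPolynomial σ k) (MvPolynomial σ k ⧸ RingHom.ker (toricMap k c d)))) ≤
        (RingHom.ker θ).restrictScalars (MvPolynomial σ k) := by
      have hJ : Ideal.ofList [(X i₀ : MvPolynomial σ k), X i₁] ≤
          RingHom.ker (θ.comp (Ideal.Quotient.mk _)) := by
        rw [Ideal.ofList, Ideal.span_le]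
        intro r hr
        simp only [Set.mem_ofPred_eq, List.mem_cons, List.not_mem_nil, or_false] at hr
        rcases hr with rfl | rfl
        · simp [θ, t0, hd.ne']
        · simp [θ, t1, hd.ne']
      refine Submodule.smul_le.2 fun r hr x _ => ?_
      have hr0 : θ (Ideal.Quotient.mk _ r) = 0 := hJ hr
      have : θ (Ideal.Quotient.mk _ r * x) = 0 := by rw [map_mul, hr0, zero_mul]
      exact this
    have h1 : θ 1 = 0 := hle (htop ▸ Submodule.mem_top)
    exact one_ne_zero ((map_one θ).symm.trans h1)

/-- The semigroup ring is integral over `k[u ^ d, v ^ d]`, since `xᵢ ^ d` maps to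
`(u ^ d) ^ c i * (v ^ d) ^ (d - c i)`. -/
theorem ringKrullDim_toric_le {σ : Type*} (c : σ → ℕ) (d : ℕ) (hd : 0 < d) (i₀ i₁ : σ)
    (h0 : c i₀ = 0) (h1 : c i₁ = d) :
    ringKrullDim (MvPolynomial σ k ⧸ RingHom.ker (toricMap k c d)) ≤ 2 := by
  let π := Ideal.Quotient.mkₐ k (RingHom.ker (toricMap k c d))
  let ψ : MvPolynomial (Fin 2) k →ₐ[k] MvPolynomial σ k ⧸ RingHom.ker (toricMap k c d) :=
    aeval ![π (X i₁), π (X i₀)]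
  algebraize [ψ.toRingHom]
  have hψ : ∀ p, algebraMap (MvPolynomial (Fin 2) k) _ p = ψ p := fun _ => rfl
  have hpow : ∀ i, π (X i) ^ d = ψ (X 0 ^ c i * X 1 ^ (d - c i)) := by
    intro i
    have : ψ (X 0 ^ c i * X 1 ^ (d - c i)) = π (X i₁ ^ c i * X i₀ ^ (d - c i)) := by
      simp [ψ]
    rw [this, ← map_pow]
    refine (Ideal.Quotient.eq).2 ?_
    rw [RingHom.mem_ker, map_sub, sub_eq_zero]
    simp only [map_mul, map_pow, toricMap_X, h0, h1, pow_zero, one_mul, Nat.sub_self, mul_one,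
      Nat.sub_zero, mul_pow, ← pow_mul]
    rw [mul_comm d, mul_comm d]
  have hint : ∀ p, IsIntegral (MvPolynomial (Fin 2) k) (π p) := by
    intro p
    induction p using MvPolynomial.induction_on with
    | C r =>
      have : π (C r) = algebraMap (MvPolynomial (Fin 2) k) _ (C r) := by
        rw [hψ]; simp [ψ, π]
      rw [this]; exact isIntegral_algebraMap
    | add p q hp hq => rw [map_add]; exact hp.add hq
    | mul_X p i hp =>
      rw [map_mul]
      refine hp.mul (IsIntegral.of_pow hd ?_)
      rw [hpow, ← hψ]; exact isIntegral_algebraMap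
  have : Algebra.IsIntegral (MvPolynomial (Fin 2) k)
      (MvPolynomial σ k ⧸ RingHom.ker (toricMap k c d)) :=
    ⟨fun x => by obtain ⟨p, rfl⟩ := Ideal.Quotient.mk_surjective x; exact hint p⟩
  refine (ringKrullDim_le_of_isIntegral (A := MvPolynomial (Fin 2) k)).trans ?_
  simp

end Toric

section Ideal

/-! ### The vanishing ideal of a monomial curve -/

open MvPolynomial
variable {k : Type*} [Field k] {n : ℕ}

theorem eval_monomialVector (a : Fin (n + 1) → ℕ) (u v : k) (F : MvPolynomial (Fin (n + 2)) k) :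
    eval (monomialVector k a u v) F =
      eval ![u, v] (toricMap k (Fin.cons 0 a : Fin (n + 2) → ℕ) (a (Fin.last n)) F) := by
  rw [toricMap, aeval_def, algebraMap_eq, ← coe_eval₂Hom, ← RingHom.comp_apply]
  congr 1
  ext i <;> simp [monomialVector]

theorem isHomogeneous_toricMap {σ : Type*} (c : σ → ℕ) (d : ℕ) (hc : ∀ i, c i ≤ d)
    {F : MvPolynomial σ k} {m : ℕ} (hF : F.IsHomogeneous m) :
    (toricMap k c d F).IsHomogeneous (d * m) := by
  refine hF.aeval (fun i => X 0 ^ c i * X 1 ^ (d - c i)) fun i => ?_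
  have := ((isHomogeneous_X k (0 : Fin 2)).pow (c i)).mul
    ((isHomogeneous_X k (1 : Fin 2)).pow (d - c i))
  rwa [one_mul, one_mul, Nat.add_sub_cancel' (hc i)] at this

theorem toricMap_homogeneousComponent_eq_zero {σ : Type*} (c : σ → ℕ) (d : ℕ) (hd : 0 < d)
    (hc : ∀ i, c i ≤ d) {F : MvPolynomial σ k} (hF : toricMap k c d F = 0) (m : ℕ) :
    toricMap k c d (homogeneousComponent m F) = 0 := by
  have h1 : ∑ i ∈ Finset.range (F.totalDegree + 1),
      toricMap k c d (homogeneousComponent i F) = 0 := by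
    rw [← map_sum, sum_homogeneousComponent, hF]
  have h2 := congrArg (homogeneousComponent (d * m)) h1
  rw [map_sum, map_zero] at h2
  have h3 : ∀ i, homogeneousComponent (d * m) (toricMap k c d (homogeneousComponent i F)) =
      if m = i then toricMap k c d (homogeneousComponent m F) else 0 := by
    intro i
    rw [homogeneousComponent_of_mem (isHomogeneous_toricMap c d hc
      (homogeneousComponent_isHomogeneous i F))]
    by_cases h : m = i
    · simp [h]
    · simp [h, hd.ne']
  simp_rw [h3] at h2
  rw [Finset.sum_ite_eq] at h2
  split_ifs at h2 with hm
  · exact h2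
  · rw [homogeneousComponent_eq_zero, map_zero]
    simpa using hm

theorem vanishesOn_projectiveMonomialCurve_iff [Infinite k] (a : Fin (n + 1) → ℕ)
    {F : MvPolynomial (Fin (n + 2)) k} {m : ℕ} (hF : F.IsHomogeneous m) :
    VanishesOn F (projectiveMonomialCurve k a) ↔
      toricMap k (Fin.cons 0 a : Fin (n + 2) → ℕ) (a (Fin.last n)) F = 0 := by
  constructor
  · intro h
    have h1 : ∀ u v : k, u ≠ 0 → eval ![u, v]
        (toricMap k (Fin.cons 0 a : Fin (n + 2) → ℕ) (a (Fin.last n)) F) = 0 := by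
      intro u v hu
      rw [← eval_monomialVector]
      refine h _ (monomialVector_ne_zero k a u v (Or.inl hu)) ?_
      intro G _ _ hG w hw hmem
      exact hG w hw ⟨u, v, Or.inl hu, hmem⟩
    -- Multiplying by `u` takes care of `(u, v) = (0, 0)`, which is not a point of the projective line.
    have h2 : X 0 * toricMap k (Fin.cons 0 a : Fin (n + 2) → ℕ) (a (Fin.last n)) F = 0 := by
      refine MvPolynomial.funext fun x => ?_
      have hx : x = ![x 0, x 1] := by ext i; fin_cases i <;> rfl
      rw [map_mul, eval_X, map_zero]
      by_cases hx0 : x 0 = 0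
      · rw [hx0, zero_mul]
      · rw [hx, h1 _ _ hx0, mul_zero]
    exact (mul_eq_zero.1 h2).resolve_left (X_ne_zero 0)
  · intro h w hw hmem
    refine hmem F m hF ?_ w hw rfl
    rintro w hw ⟨u, v, huv, hp⟩
    rw [Projectivization.mk_eq_mk_iff'] at hp
    obtain ⟨t, rfl⟩ := hp
    have : eval (t • monomialVector k a u v) F = t ^ m * eval (monomialVector k a u v) F := by
      rw [eval_eq', eval_eq', Finset.mul_sum]
      refine Finset.sum_congr rfl fun e he => ?_
      have hem : ∑ i, e i = m := by
        simpa [Finsupp.weight_apply, Finsupp.sum_fintype] using hF (mem_support_iff.1 he)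
      simp only [Pi.smul_apply, smul_eq_mul, mul_pow, Finset.prod_mul_distrib,
        Finset.prod_pow_eq_pow_sum, hem]
      ring
    rw [this, eval_monomialVector, h, map_zero, mul_zero]

theorem vanishingIdeal_projectiveMonomialCurve [Infinite k] (a : Fin (n + 1) → ℕ)
    (ha : ∀ i, a i ≤ a (Fin.last n)) (hd : 0 < a (Fin.last n)) :
    vanishingIdeal (projectiveMonomialCurve k a) =
      RingHom.ker (toricMap k (Fin.cons 0 a : Fin (n + 2) → ℕ) (a (Fin.last n))) := by
  have hc : ∀ i, (Fin.cons 0 a : Fin (n + 2) → ℕ) i ≤ a (Fin.last n) :=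
    Fin.cases (Nat.zero_le _) ha
  apply le_antisymm
  · rw [vanishingIdeal, Ideal.span_le]
    rintro F ⟨⟨m, hm⟩, hF⟩
    exact (vanishesOn_projectiveMonomialCurve_iff a hm).1 hF
  · intro F hF
    rw [← sum_homogeneousComponent F]
    refine Ideal.sum_mem _ fun i _ =>
      Ideal.subset_span ⟨⟨i, homogeneousComponent_isHomogeneous i F⟩, ?_⟩
    rw [vanishesOn_projectiveMonomialCurve_iff a (homogeneousComponent_isHomogeneous i F)]
    exact toricMap_homogeneousComponent_eq_zero _ _ hd hc hF i

theorem isArithmeticallyCohenMacaulay_of_isCohenMacaulaySequence [Infinite k]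
    (a : Fin (n + 1) → ℕ) (ha : ∀ i, a i ≤ a (Fin.last n)) (hd : 0 < a (Fin.last n))
    (h : IsCohenMacaulaySequence (Fin.cons 0 a : Fin (n + 2) → ℕ) (a (Fin.last n))) :
    IsArithmeticallyCohenMacaulay (projectiveMonomialCurve k a) := by
  have hc : ∀ i, (Fin.cons 0 a : Fin (n + 2) → ℕ) i ≤ a (Fin.last n) :=
    Fin.cases (Nat.zero_le _) ha
  have h1 : (Fin.cons 0 a : Fin (n + 2) → ℕ) (Fin.last (n + 1)) = a (Fin.last n) := rfl
  unfold IsArithmeticallyCohenMacaulay CoordinateRing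
  rw [vanishingIdeal_projectiveMonomialCurve a ha hd]
  have hreg := isRegular_toric (k := k) _ _ hd hc 0 (Fin.last (n + 1)) rfl h1 h
  have hdim : ringKrullDim (MvPolynomial (Fin (n + 2)) k ⧸
      RingHom.ker (toricMap k (Fin.cons 0 a : Fin (n + 2) → ℕ) (a (Fin.last n)))) = (2 : ℕ∞) := by
    refine le_antisymm (ringKrullDim_toric_le _ _ hd 0 (Fin.last (n + 1)) rfl h1) ?_
    rw [← Module.supportDim_quotient_eq_ringKrullDim]
    exact length_le_supportDim_of_isRegular _ _ hreg
  rw [hdim, WithBot.coe_inj]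
  refine le_antisymm (depth_le_of_ringKrullDim_le _ _ hdim.le) ?_
  refine le_iSup₂_of_le [X 0, X (Fin.last (n + 1))] ⟨?_, hreg⟩ le_rfl
  simp only [List.mem_cons, List.not_mem_nil, or_false, forall_eq_or_imp, forall_eq]
  exact ⟨Ideal.subset_span ⟨_, rfl⟩, Ideal.subset_span ⟨_, rfl⟩⟩

/-! ### Monomial curves with a large last exponent -/

theorem isCohenMacaulaySequence_snoc (a : Fin (n + 1) → ℕ)
    (ha : StrictMono a) (hpos : ∀ i, 0 < a i) (j : ℕ)
    (hM : a (Fin.last n) +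
      (a (Fin.last n) - 1) * ∑ i : Fin n, (a (Fin.last n) - a i.castSucc) ≤ j) :
    IsCohenMacaulaySequence
      (Fin.cons 0 (Fin.snoc a j : Fin (n + 2) → ℕ) : Fin (n + 3) → ℕ) j := by
  intro e f hval hdeg
  have hsum : ∀ e : Fin (n + 3) → ℕ,
      ∑ i, e i * (Fin.cons 0 (Fin.snoc a j : Fin (n + 2) → ℕ) : Fin (n + 3) → ℕ) i =
      ∑ i : Fin n, e i.castSucc.castSucc.succ * a i.castSucc +
        e (Fin.last n).castSucc.succ * a (Fin.last n) + e (Fin.last (n + 1)).succ * j := by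
    intro e
    rw [Fin.sum_univ_succ, Fin.sum_univ_castSucc, Fin.sum_univ_castSucc]
    simp
  have hsum' : ∀ e : Fin (n + 3) → ℕ,
      ∑ i, e i = e 0 + ∑ i : Fin n, e i.castSucc.castSucc.succ +
        e (Fin.last n).castSucc.succ + e (Fin.last (n + 1)).succ := by
    intro e
    rw [Fin.sum_univ_succ, Fin.sum_univ_castSucc, Fin.sum_univ_castSucc]
    ring
  suffices H : ∃ g : Fin (n + 3) → ℕ,
      ∑ i, g i * (Fin.cons 0 (Fin.snoc a j : Fin (n + 2) → ℕ) : Fin (n + 3) → ℕ) i =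
        ∑ i, e i * (Fin.cons 0 (Fin.snoc a j : Fin (n + 2) → ℕ) : Fin (n + 3) → ℕ) i ∧
      ∑ i, g i + 1 = ∑ i, e i by
    obtain ⟨g, hg⟩ := H
    exact ⟨Finsupp.equivFunOnFinite.symm g, hg⟩
  rw [hsum e, hsum f] at hval
  rw [hsum' f] at hdeg
  rw [hsum e, hdeg]
  simp_rw [hsum, hsum']
  obtain hz | ⟨s, hs⟩ : f (Fin.last (n + 1)).succ = 0 ∨ ∃ s, f (Fin.last (n + 1)).succ = s + 1 := by
    cases f (Fin.last (n + 1)).succ with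
    | zero => exact Or.inl rfl
    | succ s => exact Or.inr ⟨s, rfl⟩
  · rw [hz, zero_mul, add_zero] at hval
    obtain ⟨b, t, hb, hbt⟩ := exists_short_representation (fun i : Fin n => a i.castSucc)
      (a (Fin.last n)) j (fun i => ha.monotone (Fin.le_last _)) (hpos _) hM _ _ _ _ _ hval
    -- `z` zeros bring the number of terms up to one less than that of `e`.
    let z := f 0 + (∑ i : Fin n, f i.castSucc.castSucc.succ + f (Fin.last n).castSucc.succ) -
      (∑ i, b i + t + e (Fin.last (n + 1)).succ + 1)
    refine ⟨Fin.cons z (Fin.snoc (Fin.snoc b t : Fin (n + 1) → ℕ) (e (Fin.last (n + 1)).succ) :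
      Fin (n + 2) → ℕ), ?_, ?_⟩
    · simpa using hb
    · simp only [Fin.cons_zero, Fin.cons_succ, Fin.snoc_castSucc, Fin.snoc_last, z]
      omega
  · -- The sum for `p + j` uses `j`; drop one occurrence of it.
    refine ⟨Fin.cons (f 0) (Fin.snoc (fun i : Fin (n + 1) => f i.castSucc.succ) s :
      Fin (n + 2) → ℕ), ?_, ?_⟩
    · rw [hs, Nat.succ_mul] at hval
      simp
      simp at hval
      omega
    · simp
      simp at hs
      omega

end Ideal

end MonomialCurve

/-- The sequence `a₁ < ⋯ < a_N` of positive integers, `N = n + 1 ≥ 1`, is given as `a : Fin (n + 1) → ℕ`,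
so that `a (Fin.last n)` is its largest term (no subtraction below is truncated), and `Fin.snoc a j`
is the sequence `a₁ < ⋯ < a_N < j`. -/
theorem corollary3p2 (k : Type*) [Field k] [Infinite k] (n : ℕ) (a : Fin (n + 1) → ℕ)
    (ha : StrictMono a) (hpos : ∀ i, 0 < a i) (j : ℕ) (hj : a (Fin.last n) < j)
    (hM : a (Fin.last n) +
      (a (Fin.last n) - 1) * ∑ i : Fin n, (a (Fin.last n) - a i.castSucc) ≤ j) :
    MonomialCurve.IsArithmeticallyCohenMacaulay
      (MonomialCurve.projectiveMonomialCurve k (Fin.snoc a j : Fin (n + 2) → ℕ)) := by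
  have hlast : (Fin.snoc a j : Fin (n + 2) → ℕ) (Fin.last (n + 1)) = j := Fin.snoc_last ..
  apply MonomialCurve.isArithmeticallyCohenMacaulay_of_isCohenMacaulaySequence
  · rw [hlast]
    refine Fin.lastCases ?_ fun i => ?_
    · rw [hlast]
    · rw [Fin.snoc_castSucc]
      exact (ha.monotone (Fin.le_last i)).trans hj.le
  · rw [hlast]; omega
  · rw [hlast]
    exact MonomialCurve.isCohenMacaulaySequence_snoc a ha hpos j hM
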